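/- Let $T\subseteq\mathbb R^d$ be a (Lebesgue measurable) index set with $0\in T$. Write $\int_T\cdot\,dt$ for the sum $\sum_{t\in T}$ if $T$ is countable, and for the integral with respect to $d$-dimensional Lebesgue measure on $T$ if $T$ is uncountable. A real random field $X=\{X_t,\,t\in T\}$ is called short range dependent if for every finite measure $\mu$ on $\mathbb R$ $$\int_T\int_{\mathbb R^2}\bigl|\mathrm{Cov}\bigl(\mathbf 1(X_0>u),\mathbf 1(X_t>v)\bigr)\bigr|\,\mu(du)\,\mu(dv)\,dt<+\infty .$$ Let $Y=\{Y_t,\,t\in T\}$ be a stationary centered real Gaussian random field with $\mathrm{Var}\,Y_t=1$ for all $t\in T$, and let $\rho(t)=\mathrm{Cov}(Y_0,Y_t)$, $t\in T$. Assume that $|\rho(t)|<1$ for all $t\ne 0$ if $T$ is countable, and for Lebesgue-almost every $t\in T$ if $T$ is uncountable. Let $G:\mathbb R\to\mathbb R$ be right-continuous and strictly monotone (increasing or decreasing) with range $\mathrm{Im}(G)$, and let $X_t=G(Y_t)$, $t\in T$. Put $G^-(u)=\inf\{x: G(x)\ge u\}$ if $G$ is increasing, and $G^-(u)=\inf\{x: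 -G(x)\ge -u\}$ if $G$ is decreasing. With $\varphi$ the standard normal density and $H_k=(-1)^k\varphi^{(k)}/\varphi$ the Hermite polynomials, set, for a finite measure $\mu$ on $\mathbb R$, $$b_k(\mu)=\Bigl(\int_{\mathrm{Im}(G)}H_k(G^-(u))\,\varphi(G^-(u))\,\mu(du)\Bigr)^2,\qquad k\ge 0.$$ Suppose that for every finite measure $\mu$ on $\mathbb R$ the series $$\sum_{k=1}^\infty\frac{b_{k-1}(\mu)}{k!}\int_T|\rho(t)|\,\rho(t)^{k-1}\,dt$$ is finite, that is, the integrals occurring with a nonzero coefficient are (absolutely) convergent and the series converges in $\mathbb R$. Then $X$ is short range dependent. -/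

import Mathlib

open MeasureTheory ProbabilityTheory Filter Topology

noncomputable section

namespace IndicatorSRD

variable {d : ℕ} {T : Set (EuclideanSpace ℝ (Fin d))} {Ω : Type*} [MeasurableSpace Ω]

/-- Strict stationarity of a random field on `T ⊆ ℝ^d`: the finite-dimensional distributions are
invariant under every shift that keeps the chosen points inside `T`. -/
def IsStationary (X : T → Ω → ℝ) (P : Measure Ω) : Prop :=
  ∀ (n : ℕ) (s t : Fin n → T) (h : EuclideanSpace ℝ (Fin d)),
    (∀ i, (t i : EuclideanSpace ℝ (Fin d)) = s i + h) →
      P.map (fun ω i => X (t i) ω) = P.map (fun ω i => X (s i) ω)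

open Classical in
/-- The measure `dt` on the index set: counting measure if `T` is countable (so that integrals
over `T` are sums), and `d`-dimensional Lebesgue measure on `T` otherwise. -/
def indexMeasure (T : Set (EuclideanSpace ℝ (Fin d))) : Measure T :=
  if T.Countable then Measure.count
  else (volume : Measure (EuclideanSpace ℝ (Fin d))).comap Subtype.val

/-- `Cov (1(X_0 > u), 1(X_t > v))`. -/
def covIndicator (X : T → Ω → ℝ) (P : Measure Ω) (h0 : (0 : EuclideanSpace ℝ (Fin d)) ∈ T)
    (t : T) (u v : ℝ) : ℝ :=
  cov[{ω | u < X ⟨0, h0⟩ ω}.indicator (fun _ => (1 : ℝ)),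
    {ω | v < X t ω}.indicator (fun _ => (1 : ℝ)); P]

/-- `∫_{ℝ²} |Cov (1(X_0 > u), 1(X_t > v))| μ(du) μ(dv)`. -/
def covEnergy (X : T → Ω → ℝ) (P : Measure Ω) (h0 : (0 : EuclideanSpace ℝ (Fin d)) ∈ T)
    (μ : Measure ℝ) (t : T) : ENNReal :=
  ∫⁻ p : ℝ × ℝ, ENNReal.ofReal |covIndicator X P h0 t p.1 p.2| ∂(μ.prod μ)

/-- Short range dependence: for every finite measure `μ` on `ℝ`, the integral
`∫_T ∫_{ℝ²} |Cov (1(X_0 > u), 1(X_t > v))| μ(du) μ(dv) dt` is meaningful and finite. -/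
def IsShortRangeDependent (X : T → Ω → ℝ) (P : Measure Ω)
    (h0 : (0 : EuclideanSpace ℝ (Fin d)) ∈ T) : Prop :=
  ∀ μ : Measure ℝ, IsFiniteMeasure μ →
    AEMeasurable (covEnergy X P h0 μ) (indexMeasure T) ∧
      ∫⁻ t, covEnergy X P h0 μ t ∂(indexMeasure T) < ⊤

/-- The correlation function `ρ(t) = Cov (Y_0, Y_t)`. -/
def corr (Y : T → Ω → ℝ) (P : Measure Ω) (h0 : (0 : EuclideanSpace ℝ (Fin d)) ∈ T)
    (t : T) : ℝ :=
  cov[Y ⟨0, h0⟩, Y t; P]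

/-- `|ρ(t)| < 1` for all `t ≠ 0` if `T` is countable, and for Lebesgue almost every `t ∈ T` if
`T` is uncountable. -/
def NondegenerateCorr (ρ : T → ℝ) : Prop :=
  (T.Countable → ∀ t : T, (t : EuclideanSpace ℝ (Fin d)) ≠ 0 → |ρ t| < 1) ∧
    (¬ T.Countable →
      ∀ᵐ t ∂((volume : Measure (EuclideanSpace ℝ (Fin d))).comap (Subtype.val : T → _)),
        |ρ t| < 1)

/-- The generalized inverse `u ↦ inf {x | F x ≥ u}` of a nondecreasing function. -/
def genInv (F : ℝ → ℝ) (u : ℝ) : ℝ := sInf {x | u ≤ F x}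

open Classical in
/-- `G⁻`: the generalized inverse of `G` if `G` is increasing; if `G` is decreasing, the
generalized inverse of `-G` at `-u`, i.e. `inf {x | G x ≤ u}`. -/
def levelInv (G : ℝ → ℝ) (u : ℝ) : ℝ :=
  if StrictMono G then genInv G u else genInv (fun x => -G x) (-u)

/-- `b_k(μ) = (∫_{Im G} H_k(G⁻(u)) φ(G⁻(u)) μ(du))²`, with `H_k` the probabilists' Hermite
polynomial and `φ` the standard normal density. -/
def hermiteCoeff (G : ℝ → ℝ) (μ : Measure ℝ) (k : ℕ) : ℝ :=
  (∫ u in Set.range G, Polynomial.aeval (levelInv G u) (Polynomial.hermite k) *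
    gaussianPDFReal 0 1 (levelInv G u) ∂μ) ^ 2

/-- The series `∑_{k ≥ 1} b_{k-1}(μ) / k! * ∫_T |ρ(t)| ρ(t)^{k-1} dt` is finite: the integrals
that occur with a nonzero coefficient are finite, and the partial sums converge in `ℝ`. -/
def SeriesFinite (G : ℝ → ℝ) (ρ : T → ℝ) (μ : Measure ℝ) : Prop :=
  (∀ k : ℕ, 1 ≤ k → hermiteCoeff G μ (k - 1) ≠ 0 →
      Integrable (fun t => |ρ t| * ρ t ^ (k - 1)) (indexMeasure T)) ∧
    ∃ s : ℝ, Tendsto (fun n : ℕ => ∑ k ∈ Finset.Icc 1 n,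
      hermiteCoeff G μ (k - 1) / (Nat.factorial k : ℝ) *
        ∫ t, |ρ t| * ρ t ^ (k - 1) ∂(indexMeasure T)) atTop (𝓝 s)

end IndicatorSRD

end

/-! Write `h_k = H_k φ`. Mehler's series for the bivariate normal law, integrated over quadrants,
gives for |r| < 1 that Cov(1(U > x), 1(V > y)) = ∑_{k ≥ 0} r^(k+1)/(k+1)! h_k(x) h_k(y). This
covariance has the sign of r for all x, y (`covariance_indicator_sign`), so the absolute value may
be moved outside the integral over ν ⊗ ν: the energy of Y at t equals |∑ ρ(t)^(k+1)/(k+1)! (∫ h_k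
dν)²|. Without the sign one would only reach ∫ |h_k| dν, which the hypothesis does not control.

The given series may converge through cancellation, since ρ(t)^(k-1) can be negative. The hypothesis
holds for every finite measure, so it may be applied to ν' = ν + (reflection of ν), which dominates
ν. As h_k has the parity of k, odd coefficients of ν' vanish; for even k, |ρ| ρ^k = |ρ|^(k+1). The
series becomes one of nonnegative terms, and Tonelli bounds the integrated energy of ν', hence that
of ν (`lintegral_tsum_lt_top`, `isShortRangeDependent_gaussian`).

The general G reduces to the identity in two ways. Pushing ν forward by G turns the coefficients b_k
into those of Y (`hermiteCoeff_map`). Conversely, excursion sets of G(Y) are, up to null sets or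
complements, half-line events of Y, so the energy of G(Y) under μ is the energy of Y under another
finite measure (`exists_covEnergy_comp_eq`). -/

noncomputable section

namespace IndicatorSRD

/-! ### Hermite functions: derivatives, norms, Fourier transform, parity. -/

open Polynomial in
/-- The Hermite function `H_k φ`, where `φ` is the standard normal density. -/
def hermiteFun (k : ℕ) (x : ℝ) : ℝ :=
  aeval x (hermite k) * gaussianPDFReal 0 1 x

open Polynomial in
lemma derivative_hermite_succ (k : ℕ) :
    derivative (hermite (k + 1)) = (k + 1 : ℤ[X]) * hermite k := by
  induction k with
  | zero => simp
  | succ k ih =>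
    rw [hermite_succ (k + 1), derivative_sub, derivative_mul, ih, derivative_mul, hermite_succ k]
    have : derivative (k + 1 : ℤ[X]) = 0 := by simp
    rw [this, derivative_X]
    push_cast
    ring

lemma hasDerivAt_gaussianPDFReal (x : ℝ) :
    HasDerivAt (gaussianPDFReal 0 1) (-x * gaussianPDFReal 0 1 x) x := by
  have h : HasDerivAt (fun y : ℝ => -(y - 0) ^ 2 / (2 * ((1 : NNReal) : ℝ))) (-x) x := by
    convert! (((hasDerivAt_id x).sub_const (0 : ℝ)).pow 2).neg.div_const
      (2 * ((1 : NNReal) : ℝ)) using 1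
    simp
    ring
  convert! (h.exp).const_mul ((√(2 * Real.pi * ((1 : NNReal) : ℝ)))⁻¹) using 1
  simp only [gaussianPDFReal]
  ring

open Polynomial in
lemma hasDerivAt_hermiteFun (k : ℕ) (x : ℝ) :
    HasDerivAt (hermiteFun k) (-hermiteFun (k + 1) x) x := by
  convert! (Polynomial.hasDerivAt_aeval (hermite k) x).mul (hasDerivAt_gaussianPDFReal x) using 1
  simp only [hermiteFun, hermite_succ, map_sub, map_mul, aeval_X]
  ring

lemma continuous_hermiteFun (k : ℕ) : Continuous (hermiteFun k) :=
  continuous_iff_continuousAt.2 fun x => (hasDerivAt_hermiteFun k x).continuousAt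

lemma integrable_pow_mul_gaussianPDFReal (n : ℕ) :
    Integrable (fun x : ℝ => x ^ n * gaussianPDFReal 0 1 x) := by
  have h := (integrable_rpow_mul_exp_neg_mul_sq (b := 1 / 2) (by norm_num) (s := n)
    (by linarith [(Nat.cast_nonneg n : (0 : ℝ) ≤ n)])).const_mul ((√(2 * Real.pi))⁻¹)
  refine h.congr (ae_of_all _ fun x => ?_)
  simp only [Real.rpow_natCast, gaussianPDFReal, NNReal.coe_one, mul_one, sub_zero]
  rw [show -(1 / 2) * x ^ 2 = -x ^ 2 / 2 by ring]
  ring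

open Polynomial in
lemma integrable_aeval_mul_gaussianPDFReal (p : ℤ[X]) :
    Integrable (fun x : ℝ => aeval x p * gaussianPDFReal 0 1 x) := by
  induction p using Polynomial.induction_on' with
  | add p q hp hq => simpa [add_mul, Pi.add_def] using hp.add hq
  | monomial n a =>
    simpa [aeval_monomial, mul_assoc] using (integrable_pow_mul_gaussianPDFReal n).const_mul (a : ℝ)

lemma integrable_hermiteFun (k : ℕ) : Integrable (hermiteFun k) :=
  integrable_aeval_mul_gaussianPDFReal _

open Polynomial in
lemma integrable_hermite_mul_hermiteFun (p : ℤ[X]) (k : ℕ) :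
    Integrable (fun x => aeval x p * hermiteFun k x) := by
  simpa [hermiteFun, mul_assoc] using integrable_aeval_mul_gaussianPDFReal (p * hermite k)

open Polynomial in
lemma integral_hermite_mul_hermiteFun_succ (k : ℕ) :
    ∫ x, aeval x (hermite (k + 1)) * hermiteFun (k + 1) x
      = (k + 1) * ∫ x, aeval x (hermite k) * hermiteFun k x := by
  have h := integral_mul_deriv_eq_deriv_mul_of_integrable
    (u := fun x : ℝ => aeval x (hermite (k + 1))) (v := hermiteFun k)
    (u' := fun x => aeval x (derivative (hermite (k + 1))))
    (v' := fun x => -hermiteFun (k + 1) x)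
    (fun x _ => Polynomial.hasDerivAt_aeval _ x) (fun x _ => hasDerivAt_hermiteFun k x)
    (by simpa [Pi.mul_def] using (integrable_hermite_mul_hermiteFun (hermite (k + 1)) (k + 1)).neg)
    (integrable_hermite_mul_hermiteFun _ _) (integrable_hermite_mul_hermiteFun _ _)
  simp only [mul_neg, integral_neg, neg_inj] at h
  rw [h, ← integral_const_mul]
  refine integral_congr_ae (ae_of_all _ fun x => ?_)
  rw [derivative_hermite_succ]
  simp [mul_assoc]

open Polynomial in
lemma integral_hermite_mul_hermiteFun (k : ℕ) :
    ∫ x, aeval x (hermite k) * hermiteFun k x = (Nat.factorial k : ℝ) := by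
  induction k with
  | zero => simp [hermiteFun, integral_gaussianPDFReal_eq_one]
  | succ k ih =>
    rw [integral_hermite_mul_hermiteFun_succ, ih, Nat.factorial_succ]
    push_cast
    ring

open Polynomial in
-- Cauchy–Schwarz in L²(φ), where H_k has squared norm k!, carried out pointwise as an AM–GM
-- inequality.
lemma integral_abs_hermiteFun_le (k : ℕ) :
    ∫ x, |hermiteFun k x| ≤ √(Nat.factorial k : ℝ) := by
  set c := √(Nat.factorial k : ℝ) with hc
  have hc0 : 0 < c := Real.sqrt_pos.2 (by exact_mod_cast Nat.factorial_pos k)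
  have hcc : c * c = (Nat.factorial k : ℝ) := Real.mul_self_sqrt (Nat.cast_nonneg _)
  have hint : Integrable (fun x => (2 * c)⁻¹ * (aeval x (hermite k) * hermiteFun k x)
      + c / 2 * gaussianPDFReal 0 1 x) :=
    ((integrable_hermite_mul_hermiteFun (hermite k) k).const_mul _).add
      ((integrable_gaussianPDFReal 0 1).const_mul _)
  calc ∫ x, |hermiteFun k x|
      ≤ ∫ x, ((2 * c)⁻¹ * (aeval x (hermite k) * hermiteFun k x)
          + c / 2 * gaussianPDFReal 0 1 x) := by
        refine integral_mono (integrable_hermiteFun k).abs hint fun x => ?_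
        have hφ := gaussianPDFReal_nonneg 0 1 x
        simp only [hermiteFun, abs_mul, abs_of_nonneg hφ]
        -- AM–GM: |a| ≤ a²/(2c) + c/2. The choice c = √(k!) makes both terms integrate to c/2.
        have : |(aeval x (hermite k) : ℝ)|
            ≤ (2 * c)⁻¹ * (aeval x (hermite k) * aeval x (hermite k)) + c / 2 := by
          set a : ℝ := aeval x (hermite k)
          rw [← abs_mul_abs_self a, ← sub_nonneg]
          have : (2 * c)⁻¹ * (|a| * |a|) + c / 2 - |a| = (2 * c)⁻¹ * (|a| - c) ^ 2 := by
            field_simp; ring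
          rw [this]
          positivity
        nlinarith [mul_le_mul_of_nonneg_right this hφ]
    _ = c := by
        rw [integral_add ((integrable_hermite_mul_hermiteFun (hermite k) k).const_mul _)
          ((integrable_gaussianPDFReal 0 1).const_mul _), integral_const_mul, integral_const_mul,
          integral_hermite_mul_hermiteFun, integral_gaussianPDFReal_eq_one 0 one_ne_zero, ← hcc]
        field_simp
        ring

lemma integral_Ioi_hermiteFun_succ (k : ℕ) (x : ℝ) :
    ∫ y in Set.Ioi x, hermiteFun (k + 1) y = hermiteFun k x := by
  have hlim : Tendsto (hermiteFun k) atTop (𝓝 0) :=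
    tendsto_zero_of_hasDerivAt_of_integrableOn_Ioi (a := 0)
      (fun y _ => hasDerivAt_hermiteFun k y) (integrable_hermiteFun (k + 1)).neg.integrableOn
      (integrable_hermiteFun k).integrableOn
  have h := integral_Ioi_of_hasDerivAt_of_tendsto' (a := x)
    (fun y _ => hasDerivAt_hermiteFun k y) (integrable_hermiteFun (k + 1)).neg.integrableOn hlim
  rw [integral_neg] at h
  linarith

/-- `hermiteFun k` is the tail integral of `hermiteFun (k + 1)`, so the L¹ bound at k + 1 gives a
uniform bound at k. -/
lemma abs_hermiteFun_le (k : ℕ) (x : ℝ) :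
    |hermiteFun k x| ≤ √(Nat.factorial (k + 1) : ℝ) := by
  rw [← integral_Ioi_hermiteFun_succ]
  exact (abs_integral_le_integral_abs).trans
    ((setIntegral_le_integral (integrable_hermiteFun _).abs
      (ae_of_all _ fun _ => abs_nonneg _)).trans (integral_abs_hermiteFun_le _))

open Complex in
-- Integration by parts: each step in k contributes a factor s·i to the Gaussian characteristic
-- function.
lemma integral_cexp_mul_hermiteFun (s : ℝ) (k : ℕ) :
    ∫ x : ℝ, cexp (s * x * I) * (hermiteFun k x : ℂ) = (s * I) ^ k * cexp (-s ^ 2 / 2) := by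
  have hint (k : ℕ) : Integrable (fun x : ℝ => cexp (s * x * I) * (hermiteFun k x : ℂ)) := by
    refine (integrable_hermiteFun k).ofReal.bdd_mul (c := 1)
      (Continuous.aestronglyMeasurable (by fun_prop)) (ae_of_all _ fun x => ?_)
    rw [← ofReal_mul, norm_exp_ofReal_mul_I]
  induction k with
  | zero =>
    have h := charFun_gaussianReal (μ := 0) (v := 1) s
    rw [charFun_apply_real, integral_gaussianReal_eq_integral_smul one_ne_zero] at h
    simp only [hermiteFun, pow_zero, one_mul, Polynomial.hermite_zero, map_one]
    convert h using 1
    · refine integral_congr_ae (ae_of_all _ fun x => ?_)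
      simp [mul_comm]
    · simp [neg_div]
  | succ k ih =>
    have h := integral_mul_deriv_eq_deriv_mul_of_integrable
      (u := fun x : ℝ => cexp (s * x * I)) (v := fun x => (hermiteFun k x : ℂ))
      (u' := fun x : ℝ => cexp (s * x * I) * (s * I))
      (v' := fun x => -(hermiteFun (k + 1) x : ℂ))
      (fun x _ => by
        have : HasDerivAt (fun x : ℝ => (s * x * I : ℂ)) (s * I) x := by
          simpa using ((hasDerivAt_id x).ofReal_comp.const_mul (s : ℂ)).mul_const I
        exact this.cexp)
      (fun x _ => by simpa using (hasDerivAt_hermiteFun k x).ofReal_comp)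
      (by simpa [Pi.mul_def] using (hint (k + 1)).neg)
      (by simpa [Pi.mul_def, mul_assoc, mul_comm, mul_left_comm]
        using (hint k).const_mul (s * I : ℂ))
      (hint k)
    simp only [mul_neg, integral_neg, neg_inj] at h
    rw [h]
    simp_rw [mul_right_comm _ (s * I : ℂ)]
    rw [integral_mul_const, ih]
    ring

lemma hermiteFun_neg (k : ℕ) (x : ℝ) : hermiteFun k (-x) = (-1) ^ k * hermiteFun k x := by
  induction k generalizing x with
  | zero => simp [hermiteFun, gaussianPDFReal]
  | succ k ih =>
    have h1 : HasDerivAt (fun y => hermiteFun k (-y)) (hermiteFun (k + 1) (-x)) x := by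
      have := (hasDerivAt_hermiteFun k (-x)).comp x (hasDerivAt_neg x)
      simpa [Function.comp_def] using this
    have h2 : HasDerivAt (fun y => hermiteFun k (-y)) ((-1) ^ k * -hermiteFun (k + 1) x) x := by
      simp_rw [ih]
      exact (hasDerivAt_hermiteFun k x).const_mul _
    rw [h1.unique h2]
    ring

/-! ### Mehler's expansion of the bivariate normal law. -/

/-- A finite measure whose characteristic function is that of a signed integrable density `q`
has density `q`. -/
lemma measureReal_eq_setIntegral_of_charFunDual {E : Type*} [NormedAddCommGroup E]
    [NormedSpace ℝ E] [CompleteSpace E] [MeasurableSpace E] [BorelSpace E]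
    [SecondCountableTopology E] {κ m : Measure E} [IsFiniteMeasure κ] {q : E → ℝ}
    (hq : Integrable q m)
    (h : ∀ L : StrongDual ℝ E, charFunDual κ L = ∫ v, Complex.exp (L v * Complex.I) * (q v : ℂ) ∂m)
    {s : Set E} (hs : MeasurableSet s) : κ.real s = ∫ v in s, q v ∂m := by
  have hfin {f : E → ℝ} (hf : Integrable f m) :
      IsFiniteMeasure (m.withDensity fun v => ENNReal.ofReal (f v)) :=
    isFiniteMeasure_withDensity_ofReal hf.2
  have := hfin hq
  have hneg : Integrable (fun v => -q v) m := hq.neg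
  have := hfin hneg
  have hexp (L : StrongDual ℝ E) (ν : Measure E) [IsFiniteMeasure ν] :
      Integrable (fun v => Complex.exp (L v * Complex.I)) ν :=
    Integrable.of_bound (C := 1) (Continuous.aestronglyMeasurable (by fun_prop))
      (ae_of_all _ fun v => by rw [Complex.norm_exp_ofReal_mul_I])
  have hdens (L : StrongDual ℝ E) {f : E → ℝ} (hf : Integrable f m) :
      charFunDual (m.withDensity fun v => ENNReal.ofReal (f v)) L
        = ∫ v, (max (f v) 0 : ℝ) • Complex.exp (L v * Complex.I) ∂m := by
    rw [charFunDual_apply, integral_withDensity_eq_integral_toReal_smul₀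
      hf.aestronglyMeasurable.aemeasurable.ennreal_ofReal
      (ae_of_all _ fun _ => ENNReal.ofReal_lt_top)]
    simp_rw [ENNReal.toReal_ofReal']
  have hmax (L : StrongDual ℝ E) {f : E → ℝ} (hf : Integrable f m) :
      Integrable (fun v => (max (f v) 0 : ℝ) • Complex.exp (L v * Complex.I)) m := by
    refine (hf.pos_part.ofReal (𝕜 := ℂ)).mul_bdd (c := 1)
      (Continuous.aestronglyMeasurable (by fun_prop)) (ae_of_all _ fun v => ?_)
    rw [Complex.norm_exp_ofReal_mul_I]
  -- Since q is not known to be nonnegative, its negative part is moved to the side of κ; both sides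
  -- are then finite measures, and uniqueness of characteristic functions applies.
  have key : κ + m.withDensity (fun v => ENNReal.ofReal (-q v))
      = m.withDensity (fun v => ENNReal.ofReal (q v)) := by
    refine Measure.ext_of_charFunDual (funext fun L => ?_)
    have hadd : charFunDual (κ + m.withDensity (fun v => ENNReal.ofReal (-q v))) L
        = charFunDual κ L + charFunDual (m.withDensity (fun v => ENNReal.ofReal (-q v))) L := by
      simp_rw [charFunDual_apply]
      exact integral_add_measure (hexp L _) (hexp L _)
    rw [hadd, h, hdens L hq, hdens L hneg, ← eq_sub_iff_add_eq,
      ← integral_sub (hmax L hq) (hmax L hneg)]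
    refine integral_congr_ae (ae_of_all _ fun v => ?_)
    dsimp only
    rw [← sub_smul, Complex.real_smul, mul_comm]
    congr 2
    rcases le_total (q v) 0 with h0 | h0
    · rw [max_eq_right h0, max_eq_left (by linarith)]; ring
    · rw [max_eq_left h0, max_eq_right (by linarith)]; ring
  have hset := congrArg (fun ν : Measure E => (ν s).toReal) key
  simp only [Measure.add_apply] at hset
  rw [ENNReal.toReal_add (measure_ne_top _ _) (measure_ne_top _ _), withDensity_apply _ hs,
    withDensity_apply _ hs] at hset
  rw [integral_eq_lintegral_pos_part_sub_lintegral_neg_part hq.integrableOn, measureReal_def]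
  linarith

/-- Mehler's series, the density of the standard bivariate normal law with correlation `r`. -/
def mehler (r : ℝ) (p : ℝ × ℝ) : ℝ :=
  ∑' k : ℕ, r ^ k / (Nat.factorial k : ℝ) * (hermiteFun k p.1 * hermiteFun k p.2)

lemma summable_succ_mul_pow {r : ℝ} (hr : |r| < 1) :
    Summable fun k : ℕ => ((k : ℝ) + 1) * |r| ^ k := by
  have h1 := summable_pow_mul_geometric_of_norm_lt_one 1 (r := |r|) (by simpa using hr)
  have h2 := summable_geometric_of_lt_one (abs_nonneg r) hr
  refine (h1.add h2).congr fun k => ?_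
  ring

lemma continuous_mehler {r : ℝ} (hr : |r| < 1) : Continuous (mehler r) := by
  refine continuous_tsum (fun k => ?_) (summable_succ_mul_pow hr) fun k p => ?_
  · exact continuous_const.mul (((continuous_hermiteFun k).comp continuous_fst).mul
      ((continuous_hermiteFun k).comp continuous_snd))
  · have hk : (0 : ℝ) < Nat.factorial k := by exact_mod_cast Nat.factorial_pos k
    rw [Real.norm_eq_abs, abs_mul, abs_mul, abs_div, abs_pow, abs_of_pos hk]
    calc |r| ^ k / (Nat.factorial k : ℝ) * (|hermiteFun k p.1| * |hermiteFun k p.2|)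
        ≤ |r| ^ k / (Nat.factorial k : ℝ) *
          (√(Nat.factorial (k + 1) : ℝ) * √(Nat.factorial (k + 1) : ℝ)) := by
          gcongr <;> exact abs_hermiteFun_le _ _
      _ = ((k : ℝ) + 1) * |r| ^ k := by
          rw [Real.mul_self_sqrt (Nat.cast_nonneg _), Nat.factorial_succ]
          push_cast
          field_simp

lemma integrable_mul_hermiteFun {f : ℝ → ℂ} (hf : Measurable f) (hf1 : ∀ x, ‖f x‖ ≤ 1) (k : ℕ) :
    Integrable fun x => f x * (hermiteFun k x : ℂ) :=
  (integrable_hermiteFun k).ofReal.bdd_mul (c := 1) hf.aestronglyMeasurable (ae_of_all _ hf1)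

lemma integral_norm_mul_hermiteFun_le {f : ℝ → ℂ} (hf : Measurable f) (hf1 : ∀ x, ‖f x‖ ≤ 1)
    (k : ℕ) : ∫ x, ‖f x * (hermiteFun k x : ℂ)‖ ≤ √(Nat.factorial k : ℝ) := by
  refine (integral_mono (integrable_mul_hermiteFun hf hf1 k).norm (integrable_hermiteFun k).abs
    fun x => ?_).trans (integral_abs_hermiteFun_le k)
  simp only [norm_mul, Complex.norm_real, Real.norm_eq_abs]
  exact mul_le_of_le_one_left (abs_nonneg _) (hf1 x)

section termwise

variable {r : ℝ} {f g : ℝ → ℂ}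

lemma integrable_mehlerTerm (hf : Measurable f) (hg : Measurable g) (hf1 : ∀ x, ‖f x‖ ≤ 1)
    (hg1 : ∀ x, ‖g x‖ ≤ 1) (k : ℕ) :
    Integrable (fun p : ℝ × ℝ => ((r ^ k / (Nat.factorial k : ℝ) : ℝ) : ℂ) *
      ((f p.1 * (hermiteFun k p.1 : ℂ)) * (g p.2 * (hermiteFun k p.2 : ℂ)))) :=
  ((integrable_mul_hermiteFun hf hf1 k).mul_prod (integrable_mul_hermiteFun hg hg1 k)).const_mul _

lemma integral_norm_mehlerTerm_le (hf : Measurable f) (hg : Measurable g) (hf1 : ∀ x, ‖f x‖ ≤ 1)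
    (hg1 : ∀ x, ‖g x‖ ≤ 1) (k : ℕ) :
    ∫ p : ℝ × ℝ, ‖((r ^ k / (Nat.factorial k : ℝ) : ℝ) : ℂ) *
      ((f p.1 * (hermiteFun k p.1 : ℂ)) * (g p.2 * (hermiteFun k p.2 : ℂ)))‖ ≤ |r| ^ k := by
  have hk : (0 : ℝ) < Nat.factorial k := by exact_mod_cast Nat.factorial_pos k
  simp_rw [norm_mul (((r ^ k / (Nat.factorial k : ℝ) : ℝ) : ℂ)),
    norm_mul (f _ * (hermiteFun k _ : ℂ))]
  rw [integral_const_mul, Measure.volume_eq_prod,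
    integral_prod_mul (fun x => ‖f x * (hermiteFun k x : ℂ)‖)
    (fun x => ‖g x * (hermiteFun k x : ℂ)‖), Complex.norm_real, Real.norm_eq_abs, abs_div, abs_pow,
    abs_of_pos hk]
  calc |r| ^ k / (Nat.factorial k : ℝ) *
        ((∫ x, ‖f x * (hermiteFun k x : ℂ)‖) * ∫ x, ‖g x * (hermiteFun k x : ℂ)‖)
      ≤ |r| ^ k / (Nat.factorial k : ℝ) *
        (√(Nat.factorial k : ℝ) * √(Nat.factorial k : ℝ)) := by
        gcongr
        · exact integral_norm_mul_hermiteFun_le hf hf1 k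
        · exact integral_norm_mul_hermiteFun_le hg hg1 k
    _ = |r| ^ k := by
        rw [Real.mul_self_sqrt (Nat.cast_nonneg _)]
        field_simp

/-- The two L¹ norms contribute at most k!, which cancels the denominator and leaves a geometric
majorant. Arbitrary f, g bounded by 1 cover both uses: exponentials, to identify the law, and
half-line indicators, to evaluate it. -/
lemma hasSum_integral_mul_mehler (hr : |r| < 1) (hf : Measurable f) (hg : Measurable g)
    (hf1 : ∀ x, ‖f x‖ ≤ 1) (hg1 : ∀ x, ‖g x‖ ≤ 1) :
    HasSum (fun k : ℕ => ((r ^ k / (Nat.factorial k : ℝ) : ℝ) : ℂ) *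
      ((∫ x, f x * (hermiteFun k x : ℂ)) * ∫ x, g x * (hermiteFun k x : ℂ)))
      (∫ p : ℝ × ℝ, f p.1 * g p.2 * (mehler r p : ℂ)) := by
  have hsum : Summable fun k : ℕ => ∫ p : ℝ × ℝ, ‖((r ^ k / (Nat.factorial k : ℝ) : ℝ) : ℂ) *
      ((f p.1 * (hermiteFun k p.1 : ℂ)) * (g p.2 * (hermiteFun k p.2 : ℂ)))‖ :=
    Summable.of_nonneg_of_le (fun k => integral_nonneg fun _ => norm_nonneg _)
      (integral_norm_mehlerTerm_le hf hg hf1 hg1) (summable_geometric_of_lt_one (abs_nonneg r) hr)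
  convert! hasSum_integral_of_summable_integral_norm
    (integrable_mehlerTerm (r := r) hf hg hf1 hg1) hsum using 1
  · funext k
    rw [integral_const_mul, Measure.volume_eq_prod,
      integral_prod_mul (fun x => f x * (hermiteFun k x : ℂ))
      (fun x => g x * (hermiteFun k x : ℂ))]
  · refine integral_congr_ae (ae_of_all _ fun p => ?_)
    dsimp only
    rw [mehler, Complex.ofReal_tsum, ← tsum_mul_left]
    refine tsum_congr fun k => ?_
    push_cast
    ring

end termwise

lemma integrable_mehler {r : ℝ} (hr : |r| < 1) : Integrable (mehler r) := by
  refine ⟨(continuous_mehler hr).aestronglyMeasurable, ?_⟩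
  have hone (k : ℕ) := integrable_mehlerTerm (r := r) (f := fun _ => 1) (g := fun _ => 1)
    measurable_const measurable_const (by simp) (by simp) k
  have hle (k : ℕ) := integral_norm_mehlerTerm_le (r := r) (f := fun _ => 1) (g := fun _ => 1)
    measurable_const measurable_const (by simp) (by simp) k
  calc ∫⁻ p, ‖mehler r p‖ₑ
      ≤ ∫⁻ p : ℝ × ℝ, ∑' k : ℕ, ‖((r ^ k / (Nat.factorial k : ℝ) : ℝ) : ℂ) *
          ((1 * (hermiteFun k p.1 : ℂ)) * (1 * (hermiteFun k p.2 : ℂ)))‖ₑ := by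
        refine lintegral_mono fun p => ?_
        refine (enorm_tsum_le_tsum_enorm).trans_eq (tsum_congr fun k => ?_)
        rw [one_mul, one_mul, ← Complex.ofReal_mul, ← Complex.ofReal_mul, ← ofReal_norm,
          ← ofReal_norm, Complex.norm_real]
    _ = ∑' k : ℕ, ∫⁻ p : ℝ × ℝ, ‖((r ^ k / (Nat.factorial k : ℝ) : ℝ) : ℂ) *
          ((1 * (hermiteFun k p.1 : ℂ)) * (1 * (hermiteFun k p.2 : ℂ)))‖ₑ :=
        lintegral_tsum fun k => (hone k).aestronglyMeasurable.enorm
    _ ≤ ∑' k : ℕ, ENNReal.ofReal (|r| ^ k) := by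
        refine ENNReal.tsum_le_tsum fun k => ?_
        rw [← ofReal_integral_norm_eq_lintegral_enorm (hone k)]
        exact ENNReal.ofReal_le_ofReal (hle k)
    _ < ⊤ := (summable_geometric_of_lt_one (abs_nonneg r) hr).tsum_ofReal_lt_top

section bivariate

variable {Ω : Type*} [MeasurableSpace Ω] {P : Measure Ω} [IsProbabilityMeasure P] {U V : Ω → ℝ}

lemma variance_linear_combination (hU : MemLp U 2 P) (hV : MemLp V 2 P) (hU1 : variance U P = 1)
    (hV1 : variance V P = 1) (a b : ℝ) :
    variance (fun ω => a * U ω + b * V ω) P = a ^ 2 + 2 * a * b * cov[U, V; P] + b ^ 2 := by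
  rw [variance_fun_add (hU.const_mul a) (hV.const_mul b), variance_const_mul, variance_const_mul,
    hU1, hV1, covariance_const_mul_left, covariance_const_mul_right]
  ring

lemma charFunDual_map_prodMk (hUV : HasGaussianLaw (fun ω => (U ω, V ω)) P)
    (hU0 : ∫ ω, U ω ∂P = 0) (hV0 : ∫ ω, V ω ∂P = 0) (hU1 : variance U P = 1)
    (hV1 : variance V P = 1) (L : StrongDual ℝ (ℝ × ℝ)) :
    charFunDual (P.map fun ω => (U ω, V ω)) L
      = Complex.exp (-(((L (1, 0)) ^ 2 + 2 * L (1, 0) * L (0, 1) * cov[U, V; P]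
          + (L (0, 1)) ^ 2 : ℝ) : ℂ) / 2) := by
  have hL (x y : ℝ) : L (x, y) = L (1, 0) * x + L (0, 1) * y := by
    have : ((x, y) : ℝ × ℝ) = x • (1, 0) + y • (0, 1) := by simp
    rw [this, map_add, map_smul, map_smul, smul_eq_mul, smul_eq_mul]
    ring
  rw [hUV.charFunDual_map_eq_fun]
  simp_rw [fun ω => hL (U ω) (V ω)]
  rw [variance_linear_combination hUV.fst.memLp_two hUV.snd.memLp_two hU1 hV1]
  have : (∫ ω, L (1, 0) * U ω + L (0, 1) * V ω ∂P) = 0 := by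
    rw [integral_add (hUV.fst.integrable.const_mul _) (hUV.snd.integrable.const_mul _),
      integral_const_mul, integral_const_mul, hU0, hV0]
    simp
  congr 1
  rw [this]
  push_cast
  ring

open Complex in
-- Termwise the Fourier transform gives ∑ (-abr)^k/k! = exp(-abr), exactly the cross term of the
-- bivariate Gaussian characteristic function.
lemma integral_cexp_mul_mehler {r : ℝ} (hr : |r| < 1) (L : StrongDual ℝ (ℝ × ℝ)) :
    ∫ v, cexp (L v * I) * (mehler r v : ℂ)
      = cexp (-(((L (1, 0)) ^ 2 + 2 * L (1, 0) * L (0, 1) * r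
          + (L (0, 1)) ^ 2 : ℝ) : ℂ) / 2) := by
  set a := L (1, 0)
  set b := L (0, 1)
  have hL (p : ℝ × ℝ) : L p = a * p.1 + b * p.2 := by
    have : p = p.1 • (1, 0) + p.2 • (0, 1) := by simp
    rw [this, map_add, map_smul, map_smul, smul_eq_mul, smul_eq_mul]
    simp only [a, b]
    simp
    ring
  have hn (s x : ℝ) : ‖cexp (s * x * I)‖ ≤ 1 := by
    rw [← ofReal_mul, norm_exp_ofReal_mul_I]
  have h := hasSum_integral_mul_mehler hr (f := fun x => cexp (a * x * I))
    (g := fun x => cexp (b * x * I)) (by fun_prop) (by fun_prop) (hn a) (hn b)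
  have h2 : HasSum (fun k : ℕ => ((r ^ k / (Nat.factorial k : ℝ) : ℝ) : ℂ) *
      ((∫ x : ℝ, cexp (a * x * I) * (hermiteFun k x : ℂ))
        * ∫ x : ℝ, cexp (b * x * I) * (hermiteFun k x : ℂ)))
      (cexp (-(a * b * r)) * (cexp (-a ^ 2 / 2) * cexp (-b ^ 2 / 2))) := by
    have he := (NormedSpace.expSeries_div_hasSum_exp (𝔸 := ℂ) (-(a * b * r : ℂ))).mul_right
      (cexp (-a ^ 2 / 2) * cexp (-b ^ 2 / 2))
    rw [← Complex.exp_eq_exp_ℂ] at he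
    convert! he using 1
    funext k
    rw [integral_cexp_mul_hermiteFun, integral_cexp_mul_hermiteFun]
    have : (-(a * b * r : ℂ)) ^ k = (r : ℂ) ^ k * ((a * I) ^ k * (b * I) ^ k) := by
      rw [← mul_pow, ← mul_pow]
      congr 1
      linear_combination (-(a * b * r : ℂ)) * I_sq
    rw [this]
    push_cast
    ring
  have h3 := h.unique h2
  rw [← Complex.exp_add, ← Complex.exp_add] at h3
  convert h3 using 1
  · refine integral_congr_ae (ae_of_all _ fun p => ?_)
    dsimp only
    rw [hL, ← Complex.exp_add]
    push_cast
    ring_nf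
  · congr 1
    push_cast
    ring

lemma hasSum_measureReal_Ioi_prod {r : ℝ} (hr : |r| < 1) (hcov : cov[U, V; P] = r)
    (hUV : HasGaussianLaw (fun ω => (U ω, V ω)) P)
    (hU0 : ∫ ω, U ω ∂P = 0) (hV0 : ∫ ω, V ω ∂P = 0) (hU1 : variance U P = 1)
    (hV1 : variance V P = 1) (x y : ℝ) :
    HasSum (fun k : ℕ => r ^ k / (Nat.factorial k : ℝ) *
      ((∫ u in Set.Ioi x, hermiteFun k u) * ∫ v in Set.Ioi y, hermiteFun k v))
      ((P.map fun ω => (U ω, V ω)).real (Set.Ioi x ×ˢ Set.Ioi y)) := by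
  have hprob : IsProbabilityMeasure (P.map fun ω => (U ω, V ω)) :=
    Measure.isProbabilityMeasure_map hUV.aemeasurable
  have hset : MeasurableSet (Set.Ioi x ×ˢ Set.Ioi y) := measurableSet_Ioi.prod measurableSet_Ioi
  rw [measureReal_eq_setIntegral_of_charFunDual (integrable_mehler hr) (fun L => by
    rw [charFunDual_map_prodMk hUV hU0 hV0 hU1 hV1, integral_cexp_mul_mehler hr, hcov]) hset]
  have hb (z u : ℝ) : ‖(Set.Ioi z).indicator (fun _ => (1 : ℂ)) u‖ ≤ 1 := by
    by_cases hu : u ∈ Set.Ioi z <;> simp [hu]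
  have h := hasSum_integral_mul_mehler hr (f := (Set.Ioi x).indicator fun _ => 1)
    (g := (Set.Ioi y).indicator fun _ => 1) (measurable_const.indicator measurableSet_Ioi)
    (measurable_const.indicator measurableSet_Ioi) (hb x) (hb y)
  have hI (k : ℕ) (z : ℝ) : ∫ u, (Set.Ioi z).indicator (fun _ => (1 : ℂ)) u * (hermiteFun k u : ℂ)
      = ((∫ u in Set.Ioi z, hermiteFun k u : ℝ) : ℂ) := by
    rw [← integral_complex_ofReal, ← integral_indicator measurableSet_Ioi]
    refine integral_congr_ae (ae_of_all _ fun u => ?_)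
    by_cases hu : u ∈ Set.Ioi z <;> simp [hu]
  have hJ : ∫ p : ℝ × ℝ, (Set.Ioi x).indicator (fun _ => (1 : ℂ)) p.1 *
      (Set.Ioi y).indicator (fun _ => (1 : ℂ)) p.2 * (mehler r p : ℂ)
      = ((∫ p in Set.Ioi x ×ˢ Set.Ioi y, mehler r p : ℝ) : ℂ) := by
    rw [← integral_complex_ofReal, ← integral_indicator hset]
    refine integral_congr_ae (ae_of_all _ fun p => ?_)
    by_cases h1 : x < p.1 <;> by_cases h2 : y < p.2 <;> simp [h1, h2, Set.indicator]
  rw [hJ] at h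
  simp_rw [hI] at h
  exact_mod_cast h

end bivariate

/-! ### Covariances of half-line indicators: series and sign. -/

lemma measureReal_prod_eq_integral {α β : Type*} [MeasurableSpace α] [MeasurableSpace β]
    (κ : Measure α) (l : Measure β) [IsFiniteMeasure κ] [IsFiniteMeasure l] {S : Set (α × β)}
    (hS : MeasurableSet S) : (κ.prod l).real S = ∫ u, l.real (Prod.mk u ⁻¹' S) ∂κ := by
  rw [measureReal_def, Measure.prod_apply hS]
  simp_rw [measureReal_def]
  rw [integral_toReal (measurable_measure_prodMk_left hS).aemeasurable
    (ae_of_all _ fun _ => measure_lt_top _ _)]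

/-- Chebyshev's association inequality: g is at least g(x) on the half-line and at most g(x) off it,
so restricting to the half-line can only raise the mean. -/
lemma measureReal_Ioi_mul_integral_le {κ : Measure ℝ} [IsProbabilityMeasure κ] {g : ℝ → ℝ}
    (hg : Monotone g) (hint : Integrable g κ) (x : ℝ) :
    κ.real (Set.Ioi x) * ∫ u, g u ∂κ ≤ ∫ u in Set.Ioi x, g u ∂κ := by
  set p := κ.real (Set.Ioi x)
  have hp0 : 0 ≤ p := measureReal_nonneg
  have hp1 : p ≤ 1 := measureReal_le_one
  have hcompl : κ.real (Set.Ioi x)ᶜ = 1 - p := by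
    rw [measureReal_compl measurableSet_Ioi, probReal_univ]
  have hsplit := integral_add_compl (μ := κ) (s := Set.Ioi x) measurableSet_Ioi hint
  have h1 : p * g x ≤ ∫ u in Set.Ioi x, g u ∂κ := by
    have := setIntegral_mono_on (μ := κ) (s := Set.Ioi x) (f := fun _ => g x) (g := g)
      (integrable_const _).integrableOn hint.integrableOn measurableSet_Ioi
      (fun u hu => hg (le_of_lt hu))
    simpa [p] using this
  have h2 : ∫ u in (Set.Ioi x)ᶜ, g u ∂κ ≤ (1 - p) * g x := by
    have := setIntegral_mono_on (μ := κ) (s := (Set.Ioi x)ᶜ) (f := g) (g := fun _ => g x)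
      hint.integrableOn (integrable_const _).integrableOn measurableSet_Ioi.compl
      (fun u hu => hg (not_lt.1 hu))
    rw [setIntegral_const, hcompl] at this
    simpa using this
  rw [← hsplit]
  nlinarith [mul_le_mul_of_nonneg_left h2 hp0, mul_le_mul_of_nonneg_left h1 (sub_nonneg.2 hp1)]

section covariance

variable {Ω : Type*} [MeasurableSpace Ω] {P : Measure Ω} [IsProbabilityMeasure P] {U V : Ω → ℝ}

lemma memLp_indicator_one {A : Set Ω} (hA : NullMeasurableSet A P) :
    MemLp (A.indicator fun _ => (1 : ℝ)) 2 P :=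
  MemLp.of_bound (aestronglyMeasurable_const.indicator₀ hA) 1 (ae_of_all _ fun ω => by
    by_cases h : ω ∈ A <;> simp [h])

lemma covariance_indicator_one {A B : Set Ω} (hA : NullMeasurableSet A P)
    (hB : NullMeasurableSet B P) :
    cov[A.indicator (fun _ => (1 : ℝ)), B.indicator (fun _ => (1 : ℝ)); P]
      = P.real (A ∩ B) - P.real A * P.real B := by
  rw [covariance_eq_sub (memLp_indicator_one hA) (memLp_indicator_one hB)]
  have h (C : Set Ω) (hC : NullMeasurableSet C P) :
      ∫ ω, C.indicator (fun _ => (1 : ℝ)) ω ∂P = P.real C := by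
    rw [integral_indicator₀ hC]
    simp
  rw [h A hA, h B hB, ← h _ (hA.inter hB)]
  congr 2
  funext ω
  by_cases h1 : ω ∈ A <;> by_cases h2 : ω ∈ B <;> simp [h1, h2]

omit [IsProbabilityMeasure P] in
lemma nullMeasurableSet_lt_const (hU : AEMeasurable U P) (x : ℝ) :
    NullMeasurableSet {ω | x < U ω} P :=
  hU.nullMeasurableSet_preimage measurableSet_Ioi

omit [IsProbabilityMeasure P] in
lemma measureReal_lt_of_gaussian (hU : HasGaussianLaw U P) (hU0 : ∫ ω, U ω ∂P = 0)
    (hU1 : variance U P = 1) (x : ℝ) :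
    P.real {ω | x < U ω} = ∫ u in Set.Ioi x, hermiteFun 0 u := by
  have h : P.map U = gaussianReal 0 1 := by
    rw [hU.map_eq_gaussianReal, hU0, hU1, Real.toNNReal_one]
  have h2 : P.real {ω | x < U ω} = (P.map U).real (Set.Ioi x) := by
    rw [measureReal_def, measureReal_def,
      Measure.map_apply_of_aemeasurable hU.aemeasurable measurableSet_Ioi]
    rfl
  rw [h2, h, measureReal_def, gaussianReal_apply_eq_integral _ one_ne_zero,
    ENNReal.toReal_ofReal (integral_nonneg fun _ => gaussianPDFReal_nonneg _ _ _)]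
  simp [hermiteFun]

lemma hasSum_covariance_indicator {r : ℝ} (hr : |r| < 1) (hcov : cov[U, V; P] = r)
    (hUV : HasGaussianLaw (fun ω => (U ω, V ω)) P)
    (hU0 : ∫ ω, U ω ∂P = 0) (hV0 : ∫ ω, V ω ∂P = 0) (hU1 : variance U P = 1)
    (hV1 : variance V P = 1) (x y : ℝ) :
    HasSum (fun k : ℕ => r ^ (k + 1) / (Nat.factorial (k + 1) : ℝ) *
      (hermiteFun k x * hermiteFun k y))
      (cov[{ω | x < U ω}.indicator (fun _ => (1 : ℝ)),
        {ω | y < V ω}.indicator (fun _ => (1 : ℝ)); P]) := by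
  -- The k = 0 term is the product of the marginal probabilities; removing it turns the joint
  -- probability into the covariance and shifts the index by one.
  have h := (hasSum_nat_add_iff' 1).2 (hasSum_measureReal_Ioi_prod hr hcov hUV hU0 hV0 hU1 hV1 x y)
  simp_rw [integral_Ioi_hermiteFun_succ] at h
  convert! h using 1
  rw [covariance_indicator_one (nullMeasurableSet_lt_const hUV.fst.aemeasurable x)
    (nullMeasurableSet_lt_const hUV.snd.aemeasurable y), measureReal_lt_of_gaussian hUV.fst hU0 hU1,
    measureReal_lt_of_gaussian hUV.snd hV0 hV1, measureReal_def, measureReal_def,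
    Measure.map_apply_of_aemeasurable hUV.aemeasurable (measurableSet_Ioi.prod measurableSet_Ioi)]
  simp only [Finset.range_one, Finset.sum_singleton, pow_zero, Nat.factorial_zero, Nat.cast_one,
    div_one, one_mul]
  rfl

lemma covariance_indicator_sign (hUV : HasGaussianLaw (fun ω => (U ω, V ω)) P)
    (hU1 : variance U P = 1) (x y : ℝ) :
    0 ≤ cov[U, V; P] * cov[{ω | x < U ω}.indicator (fun _ => (1 : ℝ)),
        {ω | y < V ω}.indicator (fun _ => (1 : ℝ)); P] := by
  set r := cov[U, V; P] with hr
  -- The regression residual W = V - rU is uncorrelated with U, hence independent of it. Given U =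
  -- u, the probability of V > y is g(u) = P(W + ru > y), monotone in u in the direction of the sign
  -- of r.
  set W : Ω → ℝ := fun ω => V ω - r * U ω with hW
  have hUW : HasGaussianLaw (fun ω => (U ω, W ω)) P :=
    hUV.map_fun ((ContinuousLinearMap.fst ℝ ℝ ℝ).prod
      (ContinuousLinearMap.snd ℝ ℝ ℝ - r • ContinuousLinearMap.fst ℝ ℝ ℝ))
  have hind : IndepFun U W P := by
    refine hUW.indepFun_of_covariance_eq_zero ?_
    rw [hW, covariance_fun_sub_right hUV.fst.memLp_two hUV.snd.memLp_two
      (hUV.fst.memLp_two.const_mul r), covariance_const_mul_right,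
      covariance_self hUV.fst.aemeasurable, hU1, ← hr]
    ring
  have hUm := hUW.fst.aemeasurable
  have hWm := hUW.snd.aemeasurable
  have hmap := (indepFun_iff_map_prod_eq_prod_map_map hUm hWm).1 hind
  set κ := P.map U
  set l := P.map W
  have : IsProbabilityMeasure κ := Measure.isProbabilityMeasure_map hUm
  have : IsProbabilityMeasure l := Measure.isProbabilityMeasure_map hWm
  set B : Set (ℝ × ℝ) := {p | y < p.2 + r * p.1}
  set g : ℝ → ℝ := fun u => l.real (Prod.mk u ⁻¹' B)
  have hB : MeasurableSet B := measurableSet_lt measurable_const (by fun_prop)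
  have hgm : Measurable g := (measurable_measure_prodMk_left (ν := l) hB).ennreal_toReal
  have hgint : Integrable g κ := Integrable.of_bound (C := 1) hgm.aestronglyMeasurable
    (ae_of_all _ fun u => by
      rw [Real.norm_of_nonneg measureReal_nonneg]
      exact measureReal_le_one)
  have hPA : P.real {ω | x < U ω} = κ.real (Set.Ioi x) := by
    rw [measureReal_def, measureReal_def,
      Measure.map_apply_of_aemeasurable hUm measurableSet_Ioi]
    rfl
  have hPB : P.real {ω | y < V ω} = ∫ u, g u ∂κ := by
    change _ = ∫ u, l.real (Prod.mk u ⁻¹' B) ∂κ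
    rw [← measureReal_prod_eq_integral κ l hB, ← hmap, measureReal_def, measureReal_def,
      Measure.map_apply_of_aemeasurable hUW.aemeasurable hB]
    simp [B, W]
  have hPAB : P.real ({ω | x < U ω} ∩ {ω | y < V ω}) = ∫ u in Set.Ioi x, g u ∂κ := by
    have hAB : MeasurableSet ((Set.Ioi x ×ˢ Set.univ) ∩ B) :=
      (measurableSet_Ioi.prod MeasurableSet.univ).inter hB
    have : ∫ u in Set.Ioi x, g u ∂κ
        = ∫ u, l.real (Prod.mk u ⁻¹' ((Set.Ioi x ×ˢ Set.univ) ∩ B)) ∂κ := by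
      rw [← integral_indicator measurableSet_Ioi]
      refine integral_congr_ae (ae_of_all _ fun u => ?_)
      by_cases hu : x < u <;> simp [hu, Set.preimage, B, g]
    rw [this, ← measureReal_prod_eq_integral κ l hAB, ← hmap, measureReal_def, measureReal_def,
      Measure.map_apply_of_aemeasurable hUW.aemeasurable hAB]
    congr 2
    ext ω
    simp [B, W]
  rw [covariance_indicator_one (nullMeasurableSet_lt_const hUm x)
    (nullMeasurableSet_lt_const hUV.snd.aemeasurable y), hPA, hPB, hPAB]
  rcases le_total 0 r with h0 | h0
  · have hmono : Monotone g := fun u v huv => measureReal_mono fun w (hw : y < w + r * u) =>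
      hw.trans_le (by gcongr)
    exact mul_nonneg h0 (sub_nonneg.2 (measureReal_Ioi_mul_integral_le hmono hgint x))
  · have hanti : Antitone g := fun u v huv => measureReal_mono fun w (hw : y < w + r * v) =>
      hw.trans_le (by nlinarith)
    have := measureReal_Ioi_mul_integral_le hanti.neg hgint.neg x
    simp only [integral_neg] at this
    exact mul_nonneg_of_nonpos_of_nonpos h0 (by linarith)

end covariance

/-! ### The covariance series integrated against a product measure. -/

section energy

variable {r : ℝ} {C : ℝ → ℝ → ℝ}

lemma abs_covTerm_le (r : ℝ) (k : ℕ) (x y : ℝ) :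
    |r ^ (k + 1) / (Nat.factorial (k + 1) : ℝ) * (hermiteFun k x * hermiteFun k y)|
      ≤ |r| ^ (k + 1) := by
  have hk : (0 : ℝ) < Nat.factorial (k + 1) := by exact_mod_cast Nat.factorial_pos (k + 1)
  rw [abs_mul, abs_mul, abs_div, abs_pow, abs_of_pos hk]
  calc |r| ^ (k + 1) / (Nat.factorial (k + 1) : ℝ) * (|hermiteFun k x| * |hermiteFun k y|)
      ≤ |r| ^ (k + 1) / (Nat.factorial (k + 1) : ℝ) *
        (√(Nat.factorial (k + 1) : ℝ) * √(Nat.factorial (k + 1) : ℝ)) := by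
        gcongr <;> exact abs_hermiteFun_le _ _
    _ = |r| ^ (k + 1) := by
        rw [Real.mul_self_sqrt (Nat.cast_nonneg _)]
        field_simp

lemma hasSum_integral_covSeries (hr : |r| < 1)
    (hC : ∀ x y, HasSum (fun k : ℕ => r ^ (k + 1) / (Nat.factorial (k + 1) : ℝ) *
      (hermiteFun k x * hermiteFun k y)) (C x y)) (ν : Measure ℝ) [IsFiniteMeasure ν] :
    HasSum (fun k : ℕ => r ^ (k + 1) / (Nat.factorial (k + 1) : ℝ) *
      (∫ x, hermiteFun k x ∂ν) ^ 2) (∫ p : ℝ × ℝ, C p.1 p.2 ∂(ν.prod ν)) := by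
  have hint (k : ℕ) : Integrable (fun p : ℝ × ℝ => r ^ (k + 1) / (Nat.factorial (k + 1) : ℝ) *
      (hermiteFun k p.1 * hermiteFun k p.2)) (ν.prod ν) := by
    refine Integrable.of_bound (C := |r| ^ (k + 1)) ?_
      (ae_of_all _ fun p => abs_covTerm_le r k p.1 p.2)
    exact (continuous_const.mul (((continuous_hermiteFun k).comp continuous_fst).mul
      ((continuous_hermiteFun k).comp continuous_snd))).aestronglyMeasurable
  have hsum : Summable fun k : ℕ => ∫ p : ℝ × ℝ, ‖r ^ (k + 1) / (Nat.factorial (k + 1) : ℝ) *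
      (hermiteFun k p.1 * hermiteFun k p.2)‖ ∂(ν.prod ν) := by
    refine Summable.of_nonneg_of_le (fun k => integral_nonneg fun _ => norm_nonneg _) (fun k => ?_)
      (((summable_geometric_of_lt_one (abs_nonneg r) hr).comp_injective
        (add_left_injective 1)).mul_left ((ν.prod ν).real Set.univ))
    refine (integral_mono (hint k).norm (integrable_const (|r| ^ (k + 1)))
      fun p => abs_covTerm_le r k p.1 p.2).trans_eq ?_
    rw [integral_const, smul_eq_mul]
    rfl
  convert! hasSum_integral_of_summable_integral_norm hint hsum using 1
  · funext k
    rw [integral_const_mul, integral_prod_mul, sq]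
  · exact integral_congr_ae (ae_of_all _ fun p => (hC p.1 p.2).tsum_eq.symm)

/-- C keeps one sign over the whole plane, so integrating |C| loses nothing against |∫ C|. -/
lemma lintegral_abs_covSeries (hr : |r| < 1)
    (hC : ∀ x y, HasSum (fun k : ℕ => r ^ (k + 1) / (Nat.factorial (k + 1) : ℝ) *
      (hermiteFun k x * hermiteFun k y)) (C x y)) (hsign : ∀ x y, 0 ≤ r * C x y)
    (ν : Measure ℝ) [IsFiniteMeasure ν] :
    ∫⁻ p : ℝ × ℝ, ENNReal.ofReal |C p.1 p.2| ∂(ν.prod ν)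
      = ENNReal.ofReal |∫ p : ℝ × ℝ, C p.1 p.2 ∂(ν.prod ν)| := by
  have hgeo : Summable fun k : ℕ => |r| ^ (k + 1) :=
    (summable_geometric_of_lt_one (abs_nonneg r) hr).comp_injective (add_left_injective 1)
  have hcont : Continuous fun p : ℝ × ℝ => C p.1 p.2 := by
    have : (fun p : ℝ × ℝ => C p.1 p.2) = fun p => ∑' k : ℕ,
        r ^ (k + 1) / (Nat.factorial (k + 1) : ℝ) * (hermiteFun k p.1 * hermiteFun k p.2) :=
      funext fun p => (hC p.1 p.2).tsum_eq.symm
    rw [this]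
    exact continuous_tsum (fun k => continuous_const.mul
      (((continuous_hermiteFun k).comp continuous_fst).mul
      ((continuous_hermiteFun k).comp continuous_snd))) hgeo fun k p => abs_covTerm_le r k p.1 p.2
  have hint : Integrable (fun p : ℝ × ℝ => C p.1 p.2) (ν.prod ν) := by
    refine Integrable.of_bound (C := ∑' k : ℕ, |r| ^ (k + 1)) hcont.aestronglyMeasurable
      (ae_of_all _ fun p => ?_)
    rw [← (hC p.1 p.2).tsum_eq]
    exact tsum_of_norm_bounded hgeo.hasSum fun k => abs_covTerm_le r k p.1 p.2
  rw [← ofReal_integral_eq_lintegral_ofReal hint.abs (ae_of_all _ fun _ => abs_nonneg _)]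
  congr 1
  rcases lt_trichotomy r 0 with h | h | h
  · have hneg (x y : ℝ) : C x y ≤ 0 := nonpos_of_mul_nonneg_right (hsign x y) h
    rw [abs_of_nonpos (integral_nonpos fun p => hneg _ _), ← integral_neg]
    exact integral_congr_ae (ae_of_all _ fun p => abs_of_nonpos (hneg _ _))
  -- For r = 0 the sign hypothesis is void, but every term of the series contains a factor r.
  · have hzero (x y : ℝ) : C x y = 0 := by
      refine (hC x y).unique ?_
      simp [h]
    simp [hzero]
  · have hpos (x y : ℝ) : 0 ≤ C x y := nonneg_of_mul_nonneg_right (hsign x y) h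
    rw [abs_of_nonneg (integral_nonneg fun p => hpos _ _)]
    exact integral_congr_ae (ae_of_all _ fun p => abs_of_nonneg (hpos _ _))

end energy

/-! ### Symmetrization of the measure, and the energy of the Gaussian field. -/

lemma integral_hermiteFun_symmetrization_of_odd (ν : Measure ℝ) [IsFiniteMeasure ν] {k : ℕ}
    (hk : Odd k) : ∫ x, hermiteFun k x ∂(ν + ν.map Neg.neg) = 0 := by
  have hint (μ : Measure ℝ) [IsFiniteMeasure μ] : Integrable (hermiteFun k) μ :=
    Integrable.of_bound (C := √(Nat.factorial (k + 1) : ℝ))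
      (continuous_hermiteFun k).aestronglyMeasurable (ae_of_all _ fun x => abs_hermiteFun_le k x)
  rw [integral_add_measure (hint _) (hint _), integral_map measurable_neg.aemeasurable
    (continuous_hermiteFun k).aestronglyMeasurable]
  simp_rw [hermiteFun_neg, hk.neg_one_pow, neg_one_mul, integral_neg]
  ring

section field

variable {d : ℕ} {T : Set (EuclideanSpace ℝ (Fin d))} {Ω : Type*} [MeasurableSpace Ω]
  {P : Measure Ω} [IsProbabilityMeasure P] {Y : T → Ω → ℝ}
  {h0 : (0 : EuclideanSpace ℝ (Fin d)) ∈ T}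

omit [IsProbabilityMeasure P] in
lemma covEnergy_mono {X : T → Ω → ℝ} {μ ν : Measure ℝ} [SFinite ν] (h : μ ≤ ν) (t : T) :
    covEnergy X P h0 μ t ≤ covEnergy X P h0 ν t :=
  lintegral_mono' (Measure.prod_mono h h) le_rfl

lemma abs_covIndicator_le_one (hY : ∀ t, AEMeasurable (Y t) P) (t : T) (u v : ℝ) :
    |covIndicator Y P h0 t u v| ≤ 1 := by
  rw [covIndicator, covariance_indicator_one (nullMeasurableSet_lt_const (hY _) u)
    (nullMeasurableSet_lt_const (hY t) v), abs_le]
  set A := {ω | u < Y ⟨0, h0⟩ ω}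
  set B := {ω | v < Y t ω}
  have h1 : 0 ≤ P.real (A ∩ B) := measureReal_nonneg
  have h2 : P.real (A ∩ B) ≤ 1 := measureReal_le_one
  have h3 : 0 ≤ P.real A * P.real B := mul_nonneg measureReal_nonneg measureReal_nonneg
  have h4 : P.real A * P.real B ≤ 1 :=
    mul_le_one₀ measureReal_le_one measureReal_nonneg measureReal_le_one
  constructor <;> linarith

lemma covEnergy_lt_top (hY : ∀ t, AEMeasurable (Y t) P) (μ : Measure ℝ) [IsFiniteMeasure μ]
    (t : T) : covEnergy Y P h0 μ t < ⊤ := by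
  calc covEnergy Y P h0 μ t ≤ ∫⁻ _ : ℝ × ℝ, 1 ∂(μ.prod μ) :=
        lintegral_mono fun p => ENNReal.ofReal_le_one.2 (abs_covIndicator_le_one hY t _ _)
    _ < ⊤ := by simp [measure_lt_top]

variable (hY : IsGaussianProcess Y P) (hmean : ∀ t, ∫ ω, Y t ω ∂P = 0)
  (hvar : ∀ t, variance (Y t) P = 1)

include hY hmean hvar

lemma exists_hasSum_covEnergy {t : T} (ht : |corr Y P h0 t| < 1) (ν : Measure ℝ)
    [IsFiniteMeasure ν] :
    ∃ s : ℝ, HasSum (fun k : ℕ => corr Y P h0 t ^ (k + 1) / (Nat.factorial (k + 1) : ℝ) *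
      (∫ x, hermiteFun k x ∂ν) ^ 2) s ∧ covEnergy Y P h0 ν t = ENNReal.ofReal |s| := by
  have hC := hasSum_covariance_indicator ht rfl hY.hasGaussianLaw_prodMk (hmean _) (hmean _)
    (hvar _) (hvar _)
  exact ⟨_, hasSum_integral_covSeries ht hC ν, lintegral_abs_covSeries ht hC
    (covariance_indicator_sign hY.hasGaussianLaw_prodMk (hvar _)) ν⟩

lemma covEnergy_le_tsum {t : T} (ht : |corr Y P h0 t| < 1) (ν : Measure ℝ) [IsFiniteMeasure ν] :
    covEnergy Y P h0 ν t ≤ ∑' k : ℕ, ENNReal.ofReal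
      ((∫ x, hermiteFun k x ∂ν) ^ 2 / (Nat.factorial (k + 1) : ℝ) *
        |corr Y P h0 t| ^ (k + 1)) := by
  obtain ⟨s, hs, he⟩ := exists_hasSum_covEnergy hY hmean hvar ht ν
  rw [he, ← hs.tsum_eq, ← Real.norm_eq_abs, ofReal_norm]
  refine enorm_tsum_le_tsum_enorm.trans_eq (tsum_congr fun k => ?_)
  rw [← ofReal_norm, Real.norm_eq_abs, abs_mul, abs_div, abs_pow,
    abs_of_nonneg (sq_nonneg (∫ x, hermiteFun k x ∂ν)), Nat.abs_cast]
  congr 1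
  ring

/-- The energy is an almost everywhere limit of absolute values of polynomials in the correlation.
-/
lemma aemeasurable_covEnergy {m : Measure T} (hm : AEMeasurable (corr Y P h0) m)
    (hlt : ∀ᵐ t ∂m, |corr Y P h0 t| < 1) (ν : Measure ℝ) [IsFiniteMeasure ν] :
    AEMeasurable (covEnergy Y P h0 ν) m := by
  refine aemeasurable_of_tendsto_metrizable_ae' (f := fun n t => ENNReal.ofReal
    |∑ k ∈ Finset.range n, corr Y P h0 t ^ (k + 1) / (Nat.factorial (k + 1) : ℝ) *
      (∫ x, hermiteFun k x ∂ν) ^ 2|) (fun n => ?_) ?_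
  · have h : Measurable fun z : ℝ => ENNReal.ofReal
        |∑ k ∈ Finset.range n, z ^ (k + 1) / (Nat.factorial (k + 1) : ℝ) *
          (∫ x, hermiteFun k x ∂ν) ^ 2| := by fun_prop
    exact h.comp_aemeasurable hm
  · filter_upwards [hlt] with t ht
    obtain ⟨s, hs, he⟩ := exists_hasSum_covEnergy hY hmean hvar ht ν
    rw [he]
    exact (ENNReal.continuous_ofReal.comp continuous_abs).continuousAt.tendsto.comp
      hs.tendsto_sum_nat

end field

/-! ### The series hypothesis for the Gaussian field, and its short range dependence. -/

lemma levelInv_apply_self {G : ℝ → ℝ} (hG : StrictMono G ∨ StrictAnti G) (x : ℝ) :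
    levelInv G (G x) = x := by
  by_cases h : StrictMono G
  · have : {y | G x ≤ G y} = Set.Ici x := by ext y; simp [h.le_iff_le]
    rw [levelInv, if_pos h, genInv, this, csInf_Ici]
  · have ha := hG.resolve_left h
    have : {y | -G x ≤ -G y} = Set.Ici x := by ext y; simp [ha.le_iff_ge]
    rw [levelInv, if_neg h, genInv, this, csInf_Ici]

/-- A strictly monotone G is a measurable embedding, and `levelInv G` undoes it on its range, so the
change of variables u = G(x) removes G altogether. -/
lemma hermiteCoeff_map {G : ℝ → ℝ} (hG : StrictMono G ∨ StrictAnti G) (ν : Measure ℝ) (k : ℕ) :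
    hermiteCoeff G (ν.map G) k = (∫ x, hermiteFun k x ∂ν) ^ 2 := by
  have hm : Measurable G := hG.elim (fun h => h.monotone.measurable) fun h => h.antitone.measurable
  have hi : Function.Injective G := hG.elim StrictMono.injective StrictAnti.injective
  rw [hermiteCoeff, (hm.measurableEmbedding hi).setIntegral_map]
  simp [levelInv_apply_self hG, hermiteFun, Set.preimage_range]

section field

variable {d : ℕ} {T : Set (EuclideanSpace ℝ (Fin d))}

lemma seriesFinite_id_of_map {G : ℝ → ℝ} (hG : StrictMono G ∨ StrictAnti G) {ρ : T → ℝ}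
    {ν : Measure ℝ} (h : SeriesFinite G ρ (ν.map G)) : SeriesFinite id ρ ν := by
  have hid (k : ℕ) : hermiteCoeff id ν k = hermiteCoeff G (ν.map G) k := by
    rw [hermiteCoeff_map hG, ← hermiteCoeff_map (.inl strictMono_id), Measure.map_id]
  simpa only [SeriesFinite, hid] using h

lemma hermiteCoeff_id (ν : Measure ℝ) (k : ℕ) :
    hermiteCoeff id ν k = (∫ x, hermiteFun k x ∂ν) ^ 2 := by
  rw [← hermiteCoeff_map (.inl strictMono_id), Measure.map_id]

/-- Measurability of ρ is hidden in the integrability of |ρ|ρ, the k = 2 integral, from which ρ is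
recovered by a signed square root. The point mass at 1 works because H_1(1) φ(1) ≠ 0. -/
lemma aemeasurable_of_seriesFinite_dirac {ρ : T → ℝ}
    (h : SeriesFinite id ρ (Measure.dirac 1)) : AEMeasurable ρ (indexMeasure T) := by
  have hc : hermiteCoeff id (Measure.dirac 1) (2 - 1) ≠ 0 := by
    rw [hermiteCoeff_id, integral_dirac]
    simp [hermiteFun, (gaussianPDFReal_pos 0 1 1 one_ne_zero).ne']
  have hint := (h.1 2 one_le_two hc).aestronglyMeasurable.aemeasurable
  have hinv : Measurable fun z : ℝ => √z - √(-z) := by fun_prop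
  refine (hinv.comp_aemeasurable hint).congr (ae_of_all _ fun t => ?_)
  simp only [Function.comp, Nat.add_one_sub_one, pow_one]
  rcases le_total 0 (ρ t) with h0 | h0
  · rw [abs_of_nonneg h0, Real.sqrt_mul_self h0,
      Real.sqrt_eq_zero_of_nonpos (by nlinarith), sub_zero]
  · rw [abs_of_nonpos h0, Real.sqrt_eq_zero_of_nonpos (by nlinarith),
      show -(-ρ t * ρ t) = (-ρ t) * (-ρ t) by ring, Real.sqrt_mul_self (by linarith)]
    ring

lemma tsum_ofReal_lt_top_of_tendsto {f : ℕ → ℝ} (hf : ∀ k, 0 ≤ f k) {s : ℝ}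
    (h : Tendsto (fun n => ∑ k ∈ Finset.range n, f k) atTop (𝓝 s)) :
    ∑' k, ENNReal.ofReal (f k) < ⊤ :=
  ((hasSum_iff_tendsto_nat_of_nonneg hf s).2 h).summable.tsum_ofReal_lt_top

/-- Only even k survive, where |ρ| ρ^k = |ρ|^(k+1): all terms are nonnegative, so sum and integral
may be exchanged and convergence of the partial sums already means summability. -/
lemma lintegral_tsum_lt_top {ρ : T → ℝ} (hρ : AEMeasurable ρ (indexMeasure T)) {ν : Measure ℝ}
    (h : SeriesFinite id ρ ν) (hodd : ∀ k, Odd k → ∫ x, hermiteFun k x ∂ν = 0) :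
    ∫⁻ t, ∑' k : ℕ, ENNReal.ofReal ((∫ x, hermiteFun k x ∂ν) ^ 2 / (Nat.factorial (k + 1) : ℝ) *
      |ρ t| ^ (k + 1)) ∂(indexMeasure T) < ⊤ := by
  obtain ⟨hint, s, hs⟩ := h
  simp_rw [hermiteCoeff_id] at hint hs
  set a : ℕ → ℝ := fun k => (∫ x, hermiteFun k x ∂ν) ^ 2 with ha
  have habs (k : ℕ) (hk : ¬ Odd k) (t : T) : |ρ t| ^ (k + 1) = |ρ t| * ρ t ^ k := by
    rw [pow_succ, (Nat.not_odd_iff_even.1 hk).pow_abs, mul_comm]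
  have hodd0 (k : ℕ) (hk : Odd k) : a k = 0 := by simp [ha, hodd k hk]
  have hterm (k : ℕ) : ∫⁻ t, ENNReal.ofReal (a k / (Nat.factorial (k + 1) : ℝ) *
      |ρ t| ^ (k + 1)) ∂(indexMeasure T) = ENNReal.ofReal (a k / (Nat.factorial (k + 1) : ℝ) *
        ∫ t, |ρ t| * ρ t ^ k ∂(indexMeasure T)) := by
    -- Integrability is available only where the coefficient is nonzero; otherwise both sides
    -- vanish.
    by_cases hak : a k = 0
    · simp [hak]
    have hk : ¬ Odd k := fun hk => hak (hodd0 k hk)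
    have hi : Integrable (fun t => |ρ t| * ρ t ^ k) (indexMeasure T) :=
      hint (k + 1) (Nat.le_add_left 1 k) hak
    rw [← integral_const_mul, ofReal_integral_eq_lintegral_ofReal (hi.const_mul _)]
    · simp_rw [habs k hk]
    · refine ae_of_all _ fun t => ?_
      change 0 ≤ a k / (Nat.factorial (k + 1) : ℝ) * (|ρ t| * ρ t ^ k)
      rw [← habs k hk]
      positivity
  have hnonneg (k : ℕ) : 0 ≤ a k / (Nat.factorial (k + 1) : ℝ) *
      ∫ t, |ρ t| * ρ t ^ k ∂(indexMeasure T) := by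
    by_cases hk : Odd k
    · simp [hodd0 k hk]
    · refine mul_nonneg (by positivity) (integral_nonneg fun t => ?_)
      simp only [Pi.zero_apply, ← habs k hk]
      positivity
  rw [lintegral_tsum fun k => by fun_prop]
  rw [tsum_congr hterm]
  refine tsum_ofReal_lt_top_of_tendsto hnonneg (s := s) (hs.congr fun n => ?_)
  have hshift := Finset.sum_Ico_add' (fun k => a (k - 1) / (Nat.factorial k : ℝ) *
    ∫ t, |ρ t| * ρ t ^ (k - 1) ∂(indexMeasure T)) 0 n 1
  rw [zero_add, Finset.Ico_add_one_right_eq_Icc, ← Finset.range_eq_Ico] at hshift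
  exact hshift.symm

variable {Ω : Type*} [MeasurableSpace Ω] {P : Measure Ω} [IsProbabilityMeasure P]
  {Y : T → Ω → ℝ} {h0 : (0 : EuclideanSpace ℝ (Fin d)) ∈ T}

theorem isShortRangeDependent_gaussian (hY : IsGaussianProcess Y P)
    (hmean : ∀ t, ∫ ω, Y t ω ∂P = 0) (hvar : ∀ t, variance (Y t) P = 1)
    (hρ : NondegenerateCorr (corr Y P h0))
    (hsum : ∀ ν : Measure ℝ, IsFiniteMeasure ν → SeriesFinite id (corr Y P h0) ν) :
    IsShortRangeDependent Y P h0 := by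
  intro ν hν
  have hm := aemeasurable_of_seriesFinite_dirac (hsum (Measure.dirac 1) inferInstance)
  -- The energy has a nonnegative integrand, so it can only grow when ν is replaced by its
  -- symmetrization.
  set ν' := ν + ν.map Neg.neg with hν'
  have hle (t : T) (ht : |corr Y P h0 t| < 1) : covEnergy Y P h0 ν t ≤ ∑' k : ℕ, ENNReal.ofReal
      ((∫ x, hermiteFun k x ∂ν') ^ 2 / (Nat.factorial (k + 1) : ℝ) * |corr Y P h0 t| ^ (k + 1)) :=
    (covEnergy_mono (Measure.le_add_right le_rfl) t).trans
      (covEnergy_le_tsum hY hmean hvar ht ν')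
  have hfin := lintegral_tsum_lt_top hm (hsum ν' inferInstance)
    fun k hk => integral_hermiteFun_symmetrization_of_odd ν hk
  by_cases hT : T.Countable
  · have : Countable T := hT.to_subtype
    have hlt := hρ.1 hT
    refine ⟨(measurable_of_countable _).aemeasurable, ?_⟩
    -- The origin, where ρ = 1 and the expansion is unavailable, has counting measure 1 and finite
    -- energy, so it is split off.
    rw [← lintegral_add_compl _ (measurableSet_singleton (⟨0, h0⟩ : T)), ENNReal.add_lt_top]
    constructor
    · rw [lintegral_singleton, indexMeasure, if_pos hT, Measure.count_singleton, mul_one]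
      exact covEnergy_lt_top hY.aemeasurable ν _
    · refine (setLIntegral_mono' (measurableSet_singleton _).compl
        fun t ht => hle t (hlt t ?_)).trans_lt ((setLIntegral_le_lintegral _ _).trans_lt hfin)
      exact fun h => ht (Subtype.ext h)
  · have hlt : ∀ᵐ t ∂(indexMeasure T), |corr Y P h0 t| < 1 := by
      rw [indexMeasure, if_neg hT]
      exact hρ.2 hT
    refine ⟨aemeasurable_covEnergy hY hmean hvar hm hlt ν, ?_⟩
    exact (lintegral_mono_ae (hlt.mono hle)).trans_lt hfin

end field

/-! ### Excursion sets as half-lines, and transfer of the energy from G(Y) to Y. -/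

section upperSet

lemma Ioi_sInf_subset {s : Set ℝ} (hs : IsUpperSet s) (hne : s.Nonempty) :
    Set.Ioi (sInf s) ⊆ s := fun x hx => by
  obtain ⟨y, hy, hyx⟩ := exists_lt_of_csInf_lt hne hx
  exact hs hyx.le hy

lemma bddBelow_of_isUpperSet {s : Set ℝ} (hs : IsUpperSet s) (hne : sᶜ.Nonempty) : BddBelow s := by
  obtain ⟨z, hz⟩ := hne
  exact ⟨z, fun y hy => le_of_not_ge fun hyz => hz (hs hyz hy)⟩

lemma subset_Ici_sInf {s : Set ℝ} (hs : IsUpperSet s) (hne : sᶜ.Nonempty) :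
    s ⊆ Set.Ici (sInf s) := fun _ hx => csInf_le (bddBelow_of_isUpperSet hs hne) hx

/-- The indices `u` for which the upper set `S u` is a proper half-line. -/
def properLevels (S : ℝ → Set ℝ) : Set ℝ := {u | (S u).Nonempty ∧ (S u)ᶜ.Nonempty}

variable {S : ℝ → Set ℝ}

lemma measurableSet_properLevels (hmono : Monotone S ∨ Antitone S) :
    MeasurableSet (properLevels S) := by
  refine Set.OrdConnected.measurableSet ⟨fun u hu v hv w hw => ?_⟩
  rcases hmono with h | h
  · exact ⟨hu.1.mono (h hw.1), hv.2.mono (Set.compl_subset_compl.2 (h hw.2))⟩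
  · exact ⟨hv.1.mono (h hw.2), hu.2.mono (Set.compl_subset_compl.2 (h hw.1))⟩

lemma aemeasurable_sInf_properLevels (hS : ∀ u, IsUpperSet (S u))
    (hmono : Monotone S ∨ Antitone S) (μ : Measure ℝ) :
    AEMeasurable (fun u => sInf (S u)) (μ.restrict (properLevels S)) := by
  rcases hmono with h | h
  · exact aemeasurable_restrict_of_antitoneOn (measurableSet_properLevels (.inl h))
      fun u hu v hv huv => csInf_le_csInf (bddBelow_of_isUpperSet (hS v) hv.2) hu.1 (h huv)
  · exact aemeasurable_restrict_of_monotoneOn (measurableSet_properLevels (.inr h))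
      fun u hu v hv huv => csInf_le_csInf (bddBelow_of_isUpperSet (hS u) hu.2) hv.1 (h huv)

end upperSet

section covariance

variable {Ω : Type*} [MeasurableSpace Ω] {P : Measure Ω}

lemma covariance_congr_ae {f f' g g' : Ω → ℝ} (hf : f =ᵐ[P] f') (hg : g =ᵐ[P] g') :
    cov[f, g; P] = cov[f', g'; P] := by
  rw [covariance, covariance, integral_congr_ae hf, integral_congr_ae hg]
  refine integral_congr_ae ?_
  filter_upwards [hf, hg] with ω h1 h2
  rw [h1, h2]

lemma indicator_mem_ae_eq {U : Ω → ℝ} {s : Set ℝ} (hs : IsUpperSet s) (h1 : s.Nonempty)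
    (h2 : sᶜ.Nonempty) (hU : P {ω | U ω = sInf s} = 0) :
    {ω | U ω ∈ s}.indicator (fun _ => (1 : ℝ))
      =ᵐ[P] {ω | sInf s < U ω}.indicator fun _ => (1 : ℝ) := by
  have hne : ∀ᵐ ω ∂P, U ω ≠ sInf s := by
    rw [ae_iff]
    simpa using hU
  filter_upwards [hne] with ω hω
  have : U ω ∈ s ↔ sInf s < U ω :=
    ⟨fun h => lt_of_le_of_ne (subset_Ici_sInf hs h2 h) (Ne.symm hω),
      fun h => Ioi_sInf_subset hs h1 h⟩
  simp [Set.indicator, this]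

lemma covariance_indicator_mem_eq_zero_left [IsProbabilityMeasure P] {U g : Ω → ℝ} {s : Set ℝ}
    (h : ¬ (s.Nonempty ∧ sᶜ.Nonempty)) :
    cov[{ω | U ω ∈ s}.indicator (fun _ => (1 : ℝ)), g; P] = 0 := by
  rw [not_and_or, Set.not_nonempty_iff_eq_empty, Set.not_nonempty_iff_eq_empty,
    Set.compl_empty_iff] at h
  rcases h with h | h
  · have : {ω | U ω ∈ s}.indicator (fun _ => (1 : ℝ)) = 0 := by
      simp [h, Pi.zero_def]
    rw [this, covariance_zero_left]
  · have : {ω | U ω ∈ s}.indicator (fun _ => (1 : ℝ)) = fun _ => 1 := by simp [h]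
    rw [this, covariance_const_left]

lemma covariance_indicator_compl [IsProbabilityMeasure P] {A B : Set Ω}
    (hA : NullMeasurableSet A P) (hB : NullMeasurableSet B P) :
    cov[Aᶜ.indicator (fun _ => (1 : ℝ)), Bᶜ.indicator (fun _ => (1 : ℝ)); P]
      = cov[A.indicator (fun _ => (1 : ℝ)), B.indicator (fun _ => (1 : ℝ)); P] := by
  have h (C : Set Ω) : Cᶜ.indicator (fun _ => (1 : ℝ))
      = fun ω => 1 - C.indicator (fun _ => (1 : ℝ)) ω := by
    funext ω
    by_cases hω : ω ∈ C <;> simp [hω]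
  rw [h A, h B, covariance_const_sub_left ((memLp_indicator_one hA).integrable one_le_two),
    covariance_const_sub_right ((memLp_indicator_one hB).integrable one_le_two), neg_neg]

end covariance

section field

variable {d : ℕ} {T : Set (EuclideanSpace ℝ (Fin d))} {Ω : Type*} [MeasurableSpace Ω]
  {P : Measure Ω} [IsProbabilityMeasure P] {Y : T → Ω → ℝ}
  {h0 : (0 : EuclideanSpace ℝ (Fin d)) ∈ T}

lemma measurable_covIndicator (hY : ∀ t, AEMeasurable (Y t) P) (t : T) :
    Measurable fun p : ℝ × ℝ => covIndicator Y P h0 t p.1 p.2 := by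
  have hpair : AEMeasurable (fun ω => (Y ⟨0, h0⟩ ω, Y t ω)) P := (hY _).prodMk (hY t)
  have hprob : IsProbabilityMeasure (P.map fun ω => (Y ⟨0, h0⟩ ω, Y t ω)) :=
    Measure.isProbabilityMeasure_map hpair
  set π := P.map fun ω => (Y ⟨0, h0⟩ ω, Y t ω)
  have hA : MeasurableSet {q : (ℝ × ℝ) × ℝ × ℝ | q.1.1 < q.2.1} :=
    measurableSet_lt (by fun_prop) (by fun_prop)
  have hB : MeasurableSet {q : (ℝ × ℝ) × ℝ × ℝ | q.1.2 < q.2.2} :=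
    measurableSet_lt (by fun_prop) (by fun_prop)
  have hm {s : Set ((ℝ × ℝ) × ℝ × ℝ)} (hs : MeasurableSet s) :
      Measurable fun p => π.real (Prod.mk p ⁻¹' s) :=
    (measurable_measure_prodMk_left hs).ennreal_toReal
  have hmap {s : Set ((ℝ × ℝ) × ℝ × ℝ)} (hs : MeasurableSet s) (p : ℝ × ℝ) :
      π.real (Prod.mk p ⁻¹' s) = P.real {ω | (p, Y ⟨0, h0⟩ ω, Y t ω) ∈ s} := by
    rw [measureReal_def, measureReal_def,
      Measure.map_apply_of_aemeasurable hpair (measurable_prodMk_left hs)]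
    rfl
  convert! (hm (hA.inter hB)).sub ((hm hA).mul (hm hB)) using 1
  funext p
  simp only [Pi.sub_apply, Pi.mul_apply]
  rw [covIndicator, covariance_indicator_one (nullMeasurableSet_lt_const (hY _) _)
    (nullMeasurableSet_lt_const (hY t) _), hmap hA, hmap hB, hmap (hA.inter hB)]
  rfl

/-- Levels whose set S u is empty or everything give a constant indicator and zero covariance. At
the others S u is a half-line with endpoint sInf (S u), open or closed being immaterial because Y
has no atoms. The witness ν is the image of μ, restricted to these levels, under the endpoint map,
which is monotone or antitone there and hence almost everywhere measurable. -/
lemma exists_covEnergy_eq_of_upperSet (hY : ∀ t, AEMeasurable (Y t) P)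
    (hatom : ∀ t x, P {ω | Y t ω = x} = 0) {S : ℝ → Set ℝ} (hS : ∀ u, IsUpperSet (S u))
    (hmono : Monotone S ∨ Antitone S) (μ : Measure ℝ) [IsFiniteMeasure μ] :
    ∃ ν : Measure ℝ, IsFiniteMeasure ν ∧ ∀ t,
      ∫⁻ p : ℝ × ℝ, ENNReal.ofReal |cov[{ω | Y ⟨0, h0⟩ ω ∈ S p.1}.indicator (fun _ => (1 : ℝ)),
        {ω | Y t ω ∈ S p.2}.indicator (fun _ => (1 : ℝ)); P]| ∂(μ.prod μ)
        = covEnergy Y P h0 ν t := by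
  set A := properLevels S
  have hA : MeasurableSet A := measurableSet_properLevels hmono
  have hξ := aemeasurable_sInf_properLevels hS hmono μ
  set ξ := hξ.mk
  have hξm : Measurable ξ := hξ.measurable_mk
  have hξeq : ∀ᵐ u ∂(μ.restrict A), u ∈ A ∧ sInf (S u) = ξ u :=
    (ae_restrict_mem hA).and hξ.ae_eq_mk
  refine ⟨(μ.restrict A).map ξ, inferInstance, fun t => ?_⟩
  rw [covEnergy, Measure.map_prod_map _ _ hξm hξm,
    lintegral_map (measurable_covIndicator hY t).abs.ennreal_ofReal (hξm.prodMap hξm)]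
  have hsupp : Function.support (fun p : ℝ × ℝ =>
      ENNReal.ofReal |cov[{ω | Y ⟨0, h0⟩ ω ∈ S p.1}.indicator (fun _ => (1 : ℝ)),
        {ω | Y t ω ∈ S p.2}.indicator (fun _ => (1 : ℝ)); P]|) ⊆ A ×ˢ A := by
    refine Function.support_subset_iff'.2 fun p hp => ?_
    rw [Set.mem_prod, not_and_or] at hp
    rcases hp with hp | hp
    · rw [covariance_indicator_mem_eq_zero_left hp]
      simp
    · rw [covariance_comm, covariance_indicator_mem_eq_zero_left hp]
      simp
  rw [← setLIntegral_eq_of_support_subset hsupp, ← Measure.prod_restrict]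
  refine lintegral_congr_ae ?_
  filter_upwards [Measure.quasiMeasurePreserving_fst.ae hξeq,
    Measure.quasiMeasurePreserving_snd.ae hξeq] with p h1 h2
  rw [covariance_congr_ae
    (indicator_mem_ae_eq (hS _) h1.1.1 h1.1.2 (hatom _ _))
    (indicator_mem_ae_eq (hS _) h2.1.1 h2.1.2 (hatom _ _)), h1.2, h2.2]
  rfl

lemma exists_covEnergy_comp_eq (hY : ∀ t, AEMeasurable (Y t) P)
    (hatom : ∀ t x, P {ω | Y t ω = x} = 0) {G : ℝ → ℝ} (hG : Monotone G ∨ Antitone G)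
    (μ : Measure ℝ) [IsFiniteMeasure μ] :
    ∃ ν : Measure ℝ, IsFiniteMeasure ν ∧
      covEnergy (fun t ω => G (Y t ω)) P h0 μ = covEnergy Y P h0 ν := by
  rcases hG with hG | hG
  · obtain ⟨ν, hν, h⟩ := exists_covEnergy_eq_of_upperSet (h0 := h0) hY hatom
      (S := fun u => {x | u < G x}) (fun u x y hxy hx => lt_of_lt_of_le hx (hG hxy))
      (.inr fun u v huv x hx => lt_of_le_of_lt huv hx) μ
    exact ⟨ν, hν, funext h⟩
  · have hS (u : ℝ) : IsUpperSet {x | G x ≤ u} := fun x y hxy hx => (hG hxy).trans hx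
    obtain ⟨ν, hν, h⟩ := exists_covEnergy_eq_of_upperSet (h0 := h0) hY hatom
      (S := fun u => {x | G x ≤ u}) hS (.inl fun u v huv x hx => le_trans hx huv) μ
    refine ⟨ν, hν, funext fun t => ?_⟩
    rw [← h t]
    refine lintegral_congr fun p => ?_
    have hm (t : T) (u : ℝ) : NullMeasurableSet {ω | Y t ω ∈ {x | G x ≤ u}} P :=
      (hY t).nullMeasurableSet_preimage (hS u).ordConnected.measurableSet
    -- For decreasing G the set {G > u} is a lower set; complementing both events leaves the
    -- covariance unchanged and gives upper sets.
    rw [← covariance_indicator_compl (hm _ _) (hm _ _)]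
    simp only [covIndicator, Set.mem_ofPred_eq, Set.compl_ofPred, not_le]

end field

end IndicatorSRD

end

open IndicatorSRD in
theorem mainTheorem2 {d : ℕ} (T : Set (EuclideanSpace ℝ (Fin d)))
    (hT : NullMeasurableSet T volume) (h0 : (0 : EuclideanSpace ℝ (Fin d)) ∈ T)
    {Ω : Type*} [MeasurableSpace Ω] (P : Measure Ω) [IsProbabilityMeasure P]
    (Y : T → Ω → ℝ)
    (hY : IsGaussianProcess Y P) (hstat : IsStationary Y P)
    (hmean : ∀ t, ∫ ω, Y t ω ∂P = 0) (hvar : ∀ t, variance (Y t) P = 1)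
    (hρ : NondegenerateCorr (corr Y P h0))
    (G : ℝ → ℝ) (hG : StrictMono G ∨ StrictAnti G)
    (hGr : ∀ x, ContinuousWithinAt G (Set.Ici x) x)
    (hsum : ∀ μ : Measure ℝ, IsFiniteMeasure μ → SeriesFinite G (corr Y P h0) μ) :
    IsShortRangeDependent (fun t ω => G (Y t ω)) P h0 := by
  have hYsrd : IsShortRangeDependent Y P h0 :=
    isShortRangeDependent_gaussian hY hmean hvar hρ fun ν _ =>
      seriesFinite_id_of_map hG (hsum (ν.map G) inferInstance)
  have hatom (t : T) (x : ℝ) : P {ω | Y t ω = x} = 0 := by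
    have hlaw : P.map (Y t) = gaussianReal 0 1 := by
      rw [(hY.hasGaussianLaw_eval t).map_eq_gaussianReal, hmean, hvar, Real.toNNReal_one]
    have : NullSingletonClass (gaussianReal 0 1) :=
      nullSingletonClass_gaussianReal one_ne_zero
    have hx : P.map (Y t) {x} = 0 := by rw [hlaw, measure_singleton]
    rwa [Measure.map_apply_of_aemeasurable (hY.aemeasurable t) (measurableSet_singleton x)] at hx
  intro μ hμ
  obtain ⟨ν, hν, hμν⟩ := exists_covEnergy_comp_eq (h0 := h0) hY.aemeasurable hatom
    (hG.imp StrictMono.monotone StrictAnti.antitone) μ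
  rw [hμν]
  exact hYsrd ν hν
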